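/- Let $N\ge 2$ and let $\mathcal D\subset\{0,1,\dots,N-1\}^2$ be a digit set with $1<|\mathcal D|<N^2$. For $i\in\mathcal D$ put $\varphi_i(x)=\frac1N(x+i)$, $x\in\mathbb R^2$, and let $F=F(N,\mathcal D)$ be the generalized Sierpiński carpet, i.e. the unique non-empty compact set with $F=\bigcup_{i\in\mathcal D}\varphi_i(F)$. For a word $\mathbf i=i_1\cdots i_n\in\mathcal D^n$ write $\varphi_{\mathbf i}=\varphi_{i_1}\circ\cdots\circ\varphi_{i_n}$. A point $x$ of a connected space $X$ is a cut point of $X$ if $X\setminus\{x\}$ is not connected, and a local cut point of $X$ if $x$ is a cut point of some connected neighborhood of $x$ in $X$. **Theorem 1.4.** Suppose that $F$ is connected and has no cut points. Then $F$ has a local cut point if and only if, for $n=1$ or $n=2$, there are disjoint subsets $I,J$ of $\mathcal D^n$ such that 1. $\big(\bigcup_{\mathbf i\in I}\varphi_{\mathbf i}(F)\big)\cap\big(\bigcup_{\mathbf i\in J}\varphi_{\mathbf i}(F)\big)$ is a singleton, denoted by $\{x\}$; 2. $I\cup J=\{\mathbf i\in\mathcal D^n: x\in\varphi_{\mathbf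 i}(F)\}$. -/

import Mathlib

open Set Topology

namespace GSC

/-- The similarity `φ_i(x) = (x + i) / N` of the plane, for a digit `i ∈ {0, …, N-1}²`. -/
noncomputable def phi (N : ℕ) (i : Fin N × Fin N) (x : ℝ × ℝ) : ℝ × ℝ :=
  ((x.1 + (i.1 : ℕ)) / N, (x.2 + (i.2 : ℕ)) / N)

/-- `K` is the self-similar attractor of `{φ_i : i ∈ D}`: a non-empty compact set with
`K = ⋃_{i ∈ D} φ_i(K)`. -/
def IsAttractor (N : ℕ) (D : Finset (Fin N × Fin N)) (K : Set (ℝ × ℝ)) : Prop :=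
  K.Nonempty ∧ IsCompact K ∧ K = ⋃ i ∈ D, phi N i '' K

/-- The approximations `Q_0 = [0,1]²`, `Q_{n+1} = ⋃_{i ∈ D} φ_i(Q_n)`. -/
noncomputable def approx (N : ℕ) (D : Finset (Fin N × Fin N)) : ℕ → Set (ℝ × ℝ)
  | 0 => Icc 0 1 ×ˢ Icc 0 1
  | n + 1 => ⋃ i ∈ D, phi N i '' approx N D n

/-- The generalized Sierpiński carpet `F(N, D)`, as the intersection of the approximations.
`isAttractor_iff` shows that it is the unique attractor of `{φ_i : i ∈ D}`. -/
noncomputable def carpet (N : ℕ) (D : Finset (Fin N × Fin N)) : Set (ℝ × ℝ) :=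
  ⋂ n, approx N D n

/-- For a word `w = i_1 ⋯ i_n ∈ D^n`, the map `φ_w = φ_{i_1} ∘ ⋯ ∘ φ_{i_n}`. -/
noncomputable def phiWord (N : ℕ) (D : Finset (Fin N × Fin N)) :
    (n : ℕ) → (Fin n → D) → ℝ × ℝ → ℝ × ℝ
  | 0, _ => id
  | n + 1, w => phi N (w 0 : Fin N × Fin N) ∘ phiWord N D n (fun k => w k.succ)

/-- The cell `φ_w(F)` of the carpet `F = F(N, D)` for a word `w ∈ D^n`. -/
noncomputable def cell (N : ℕ) (D : Finset (Fin N × Fin N)) {n : ℕ} (w : Fin n → D) :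
    Set (ℝ × ℝ) :=
  phiWord N D n w '' carpet N D

/-- `x` is a cut point of (the connected set) `X`: `x ∈ X` and `X \ {x}` is not connected. -/
def IsCutPoint {α : Type*} [TopologicalSpace α] (X : Set α) (x : α) : Prop :=
  x ∈ X ∧ ¬ IsPreconnected (X \ {x})

/-- `x` is a local cut point of `X`: `x ∈ X` is a cut point of some connected neighbourhood `U`
of `x` in the space `X` (neighbourhoods need not be open). -/
def IsLocalCutPoint {α : Type*} [TopologicalSpace α] (X : Set α) (x : α) : Prop :=
  x ∈ X ∧ ∃ U : Set α, U ⊆ X ∧ U ∈ 𝓝[X] x ∧ IsConnected U ∧ IsCutPoint U x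

/-! The carpet is the unique attractor. -/

theorem continuous_phi (N : ℕ) (i : Fin N × Fin N) : Continuous (phi N i) := by
  unfold phi; fun_prop

theorem phi_injective (N : ℕ) (i : Fin N × Fin N) : Function.Injective (phi N i) := by
  have hN : (N : ℝ) ≠ 0 := by
    have := i.1.pos
    positivity
  intro x y h
  simp only [phi, Prod.mk.injEq] at h
  obtain ⟨h1, h2⟩ := h
  field_simp at h1 h2
  ext <;> linarith

theorem dist_phi (N : ℕ) (i : Fin N × Fin N) (x y : ℝ × ℝ) :
    dist (phi N i x) (phi N i y) = dist x y / N := by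
  have h (a b c : ℝ) : dist ((a + c) / N) ((b + c) / N) = dist a b / N := by
    rw [Real.dist_eq, Real.dist_eq, ← sub_div, abs_div, Nat.abs_cast]
    congr 2; ring
  simp only [phi, Prod.dist_eq, h]
  exact max_div_div_right (Nat.cast_nonneg N) _ _

theorem isCompact_approx (N : ℕ) (D : Finset (Fin N × Fin N)) (n : ℕ) :
    IsCompact (approx N D n) := by
  induction n with
  | zero => exact isCompact_Icc.prod isCompact_Icc
  | succ n ih =>
    exact D.isCompact_biUnion fun i _ => ih.image (continuous_phi N i)

theorem approx_nonempty (N : ℕ) (D : Finset (Fin N × Fin N)) (hD : D.Nonempty) (n : ℕ) :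
    (approx N D n).Nonempty := by
  induction n with
  | zero => exact ⟨(0, 0), by simp [approx]⟩
  | succ n ih =>
    obtain ⟨i, hi⟩ := hD
    obtain ⟨x, hx⟩ := ih
    exact ⟨phi N i x, mem_biUnion hi ⟨x, hx, rfl⟩⟩

theorem approx_succ_subset (N : ℕ) (D : Finset (Fin N × Fin N)) (n : ℕ) :
    approx N D (n + 1) ⊆ approx N D n := by
  induction n with
  | zero =>
    refine iUnion₂_subset fun i _ => ?_
    rintro _ ⟨x, ⟨⟨h1, h2⟩, h3, h4⟩, rfl⟩
    have hN : (0 : ℝ) < N := by exact_mod_cast i.1.pos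
    have a1 : ((i.1 : ℕ) : ℝ) + 1 ≤ N := by exact_mod_cast i.1.isLt
    have a2 : ((i.2 : ℕ) : ℝ) + 1 ≤ N := by exact_mod_cast i.2.isLt
    refine ⟨⟨?_, ?_⟩, ?_, ?_⟩ <;> simp only [phi]
    · positivity
    · rw [div_le_one hN]; linarith
    · positivity
    · rw [div_le_one hN]; linarith
  | succ n ih => exact iUnion₂_mono fun i _ => image_mono ih

theorem isAttractor_carpet (N : ℕ) (D : Finset (Fin N × Fin N)) (hD : D.Nonempty) :
    IsAttractor N D (carpet N D) := by
  have anti : Antitone (approx N D) := antitone_nat_of_succ_le (approx_succ_subset N D)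
  refine ⟨?_, ?_, Subset.antisymm ?_ ?_⟩
  · exact IsCompact.nonempty_iInter_of_sequence_nonempty_isCompact_isClosed _
      (approx_succ_subset N D) (approx_nonempty N D hD) (isCompact_approx N D 0)
      fun n => (isCompact_approx N D n).isClosed
  · exact (isCompact_approx N D 0).of_isClosed_subset
      (isClosed_iInter fun n => (isCompact_approx N D n).isClosed) (iInter_subset _ 0)
  · intro x hx
    by_contra hcon
    simp only [mem_iUnion, not_exists] at hcon
    have key : ∀ i ∈ D, ∃ n, x ∉ phi N i '' approx N D n := by
      intro i hi
      by_contra! h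
      apply hcon i hi
      obtain ⟨y, -, hy⟩ := h 0
      refine ⟨y, mem_iInter.2 fun n => ?_, hy⟩
      obtain ⟨z, hz, hzx⟩ := h n
      rwa [← phi_injective N i (hzx.trans hy.symm)]
    choose! f hf using key
    have hx' : x ∈ approx N D (D.sup f + 1) := mem_iInter.1 hx _
    simp only [approx, mem_iUnion] at hx'
    obtain ⟨i, hi, hxi⟩ := hx'
    exact hf i hi (image_mono (anti (Finset.le_sup hi)) hxi)
  · refine iUnion₂_subset fun i hi => ?_
    rintro _ ⟨x, hx, rfl⟩
    refine mem_iInter.2 fun n => approx_succ_subset N D n ?_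
    exact mem_biUnion hi ⟨x, mem_iInter.1 hx n, rfl⟩

theorem IsAttractor.subset {N : ℕ} {D : Finset (Fin N × Fin N)} (hN : 2 ≤ N)
    {K L : Set (ℝ × ℝ)} (hK : IsAttractor N D K) (hL : IsAttractor N D L) : K ⊆ L := by
  obtain ⟨hK1, hK2, hK3⟩ := hK
  obtain ⟨hL1, hL2, hL3⟩ := hL
  obtain ⟨x, hxK, hx⟩ := hK2.exists_isMaxOn hK1
    (Metric.continuous_infDist_pt L).continuousOn
  have hx0 : Metric.infDist x L ≤ 0 := by
    have hx' := hxK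
    rw [hK3] at hx'
    simp only [mem_iUnion] at hx'
    obtain ⟨i, hi, y, hy, rfl⟩ := hx'
    obtain ⟨z, hz, hyz⟩ := hL2.exists_infDist_eq_dist hL1 y
    have hz' : phi N i z ∈ L := by
      rw [hL3]; exact mem_biUnion hi ⟨z, hz, rfl⟩
    have h1 := Metric.infDist_le_dist_of_mem (x := phi N i y) hz'
    rw [dist_phi, ← hyz] at h1
    have h2 : Metric.infDist y L ≤ Metric.infDist (phi N i y) L := hx hy
    have h3 : Metric.infDist y L / N ≤ Metric.infDist y L / 2 :=
      div_le_div_of_nonneg_left Metric.infDist_nonneg (by norm_num) (by exact_mod_cast hN)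
    linarith
  intro y hy
  rw [hL2.isClosed.mem_iff_infDist_zero hL1]
  exact le_antisymm ((hx hy).trans hx0) Metric.infDist_nonneg

theorem isAttractor_iff {N : ℕ} (hN : 2 ≤ N) {D : Finset (Fin N × Fin N)} (hD : D.Nonempty)
    (K : Set (ℝ × ℝ)) : IsAttractor N D K ↔ K = carpet N D := by
  have h := isAttractor_carpet N D hD
  exact ⟨fun hK => (hK.subset hN h).antisymm (h.subset hN hK), fun e => e ▸ h⟩

end GSC

namespace GSC

variable {N : ℕ} {D : Finset (Fin N × Fin N)}

/-! Near a local cut point `x`, the level-`n` cells containing `x` form, for large `n`, a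
neighbourhood that `x` still disconnects. No single cell is cut by `x`, because `F` has no cut
points, so the cells fall into two classes meeting only at `x` (`exists_splits_of_isLocalCutPoint`).
After rescaling, this depends only on the positions of `x` inside its cells, recorded by `offsets`.

It remains to find every such set of positions at level 1 or 2 (`exists_offsets_level_le_two`). At a
vertex of the grid one level up, the parent level shows the same offsets, so induction applies. Any
other point meets at most two parent squares, sharing an edge. A lone parent looks like the unit
square at level 0, and an adjacent pair already occurs at level 1; their children have level 1 or 2.

Conversely, the cells around `x` form a connected neighbourhood, and the two classes are closed sets
separating it at `x` (`isLocalCutPoint_of_words`). -/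

/-! ### Cells as scaled integer translates of the carpet -/

/-- An integer vector as a point of the plane. -/
def toPlane (e : ℤ × ℤ) : ℝ × ℝ := (e.1, e.2)

theorem toPlane_add (a b : ℤ × ℤ) : toPlane (a + b) = toPlane a + toPlane b := by
  simp [toPlane]

/-- The integer vector of a digit. -/
def digitVec (d : Fin N × Fin N) : ℤ × ℤ := ((d.1 : ℕ), (d.2 : ℕ))

theorem phi_eq (d : Fin N × Fin N) (f : ℝ × ℝ) :
    phi N d f = (N : ℝ)⁻¹ • (f + toPlane (digitVec d)) := by
  ext <;> simp [phi, toPlane, digitVec, div_eq_inv_mul, mul_add]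

/-- The lower left corners, in units of `N⁻ⁿ`, of the squares of level `n`. -/
def blocks (N : ℕ) (D : Finset (Fin N × Fin N)) : ℕ → Set (ℤ × ℤ)
  | 0 => {0}
  | n + 1 => {p | ∃ e ∈ blocks N D n, ∃ d ∈ D, p = (N : ℤ) • e + digitVec d}

theorem finite_blocks (N : ℕ) (D : Finset (Fin N × Fin N)) (n : ℕ) : (blocks N D n).Finite := by
  induction n with
  | zero => exact finite_singleton 0
  | succ n ih =>
    refine ((ih.prod D.finite_toSet).image
      fun q => (N : ℤ) • q.1 + digitVec q.2).subset ?_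
    rintro p ⟨e, he, d, hd, rfl⟩
    exact ⟨(e, d), ⟨he, hd⟩, rfl⟩

/-- `blocks` appends the finest digit, whereas `phiWord` peels off the coarsest; this reconciles the
two recursions. -/
theorem mem_blocks_succ_iff_prefix (n : ℕ) (p : ℤ × ℤ) :
    p ∈ blocks N D (n + 1) ↔
      ∃ d ∈ D, ∃ e ∈ blocks N D n, p = (N : ℤ) ^ n • digitVec d + e := by
  induction n generalizing p with
  | zero => simp [blocks]
  | succ n ih =>
    constructor
    · rintro ⟨q, hq, d, hd, rfl⟩
      obtain ⟨i, hi, e, he, rfl⟩ := (ih q).1 hq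
      refine ⟨i, hi, _, ⟨e, he, d, hd, rfl⟩, ?_⟩
      rw [smul_add, smul_smul, pow_succ', add_assoc]
    · rintro ⟨i, hi, _, ⟨e, he, d, hd, rfl⟩, rfl⟩
      refine ⟨_, (ih _).2 ⟨i, hi, e, he, rfl⟩, d, hd, ?_⟩
      rw [smul_add, smul_smul, pow_succ', add_assoc]

theorem exists_block_of_word (n : ℕ) (w : Fin n → D) :
    ∃ e ∈ blocks N D n, ∀ f, phiWord N D n w f = ((N : ℝ) ^ n)⁻¹ • (f + toPlane e) := by
  induction n with
  | zero => exact ⟨0, rfl, fun f => by simp [phiWord, toPlane]⟩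
  | succ n ih =>
    obtain ⟨e, he, h⟩ := ih fun k => w k.succ
    refine ⟨_, (mem_blocks_succ_iff_prefix n _).2 ⟨_, (w 0).2, e, he, rfl⟩, fun f => ?_⟩
    have hN : (N : ℝ) ≠ 0 := by
      have := (w 0).1.1.pos
      positivity
    simp only [phiWord, Function.comp, h, phi_eq]
    ext <;> simp [toPlane] <;> field_simp <;> ring

theorem exists_word_of_block (n : ℕ) (e : ℤ × ℤ) (he : e ∈ blocks N D n) :
    ∃ w : Fin n → D, ∀ f, phiWord N D n w f = ((N : ℝ) ^ n)⁻¹ • (f + toPlane e) := by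
  induction n generalizing e with
  | zero =>
    obtain rfl : e = 0 := he
    exact ⟨Fin.elim0, fun f => by simp [phiWord, toPlane]⟩
  | succ n ih =>
    obtain ⟨d, hd, e', he', rfl⟩ := (mem_blocks_succ_iff_prefix n _).1 he
    obtain ⟨w, hw⟩ := ih e' he'
    refine ⟨Fin.cons ⟨d, hd⟩ w, fun f => ?_⟩
    have hN : (N : ℝ) ≠ 0 := by
      have := d.1.pos
      positivity
    simp only [phiWord, Function.comp, Fin.cons_succ, Fin.cons_zero, hw, phi_eq]
    ext <;> simp [toPlane] <;> field_simp <;> ring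

theorem mem_carpet_iff (hD : D.Nonempty) (x : ℝ × ℝ) :
    x ∈ carpet N D ↔ ∃ d ∈ D, ∃ f ∈ carpet N D, phi N d f = x := by
  conv_lhs => rw [(isAttractor_carpet N D hD).2.2]
  simp only [mem_iUnion, mem_image, exists_prop]

theorem carpet_subset (N : ℕ) (D : Finset (Fin N × Fin N)) :
    carpet N D ⊆ Icc 0 1 ×ˢ Icc 0 1 :=
  iInter_subset _ 0

theorem mem_carpet_iff_blocks (hD : D.Nonempty) (n : ℕ) (x : ℝ × ℝ) :
    x ∈ carpet N D ↔
      ∃ e ∈ blocks N D n, ∃ f ∈ carpet N D, x = ((N : ℝ) ^ n)⁻¹ • (f + toPlane e) := by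
  have hN : (N : ℝ) ≠ 0 := by
    obtain ⟨d, -⟩ := hD
    have := d.1.pos
    positivity
  induction n with
  | zero =>
    have : toPlane 0 = 0 := by simp [toPlane]
    simp only [blocks, mem_singleton_iff, exists_eq_left, pow_zero, inv_one, one_smul, this,
      add_zero, exists_eq_right']
  | succ n ih =>
    have key (e : ℤ × ℤ) (d : Fin N × Fin N) (g : ℝ × ℝ) :
        ((N : ℝ) ^ n)⁻¹ • (phi N d g + toPlane e) =
          ((N : ℝ) ^ (n + 1))⁻¹ • (g + toPlane ((N : ℤ) • e + digitVec d)) := by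
      rw [phi_eq]
      ext <;> simp [toPlane] <;> field_simp <;> ring
    refine ih.trans ⟨?_, ?_⟩
    · rintro ⟨e, he, f, hf, rfl⟩
      obtain ⟨d, hd, g, hg, rfl⟩ := (mem_carpet_iff hD f).1 hf
      exact ⟨_, ⟨e, he, d, hd, rfl⟩, g, hg, key e d g⟩
    · rintro ⟨_, ⟨e, he, d, hd, rfl⟩, g, hg, rfl⟩
      exact ⟨e, he, _, (mem_carpet_iff hD _).2 ⟨d, hd, g, hg, rfl⟩, (key e d g).symm⟩

/-! ### Local patterns of cells around a point -/

/-- The positions of `y` relative to the unit-size copies `F + e` of the carpet that contain it,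
where `e` runs through the blocks of level `n`. -/
def offsets (N : ℕ) (D : Finset (Fin N × Fin N)) (n : ℕ) (y : ℝ × ℝ) : Set (ℝ × ℝ) :=
  {v | v ∈ carpet N D ∧ ∃ e ∈ blocks N D n, y = v + toPlane e}

/-- The translates `F - v`, `v ∈ A`, fall into two classes whose unions meet only at `0`. -/
def Splits (F A : Set (ℝ × ℝ)) : Prop :=
  ∃ I J : Set (ℝ × ℝ), Disjoint I J ∧ I ∪ J = A ∧
    ∀ z, ((∃ v ∈ I, z + v ∈ F) ∧ ∃ v ∈ J, z + v ∈ F) ↔ z = 0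

theorem Splits.nontrivial {F A : Set (ℝ × ℝ)} (h : Splits F A) : A.Nontrivial := by
  obtain ⟨I, J, hIJ, rfl, h⟩ := h
  obtain ⟨⟨v, hv, -⟩, w, hw, -⟩ := (h 0).2 rfl
  exact ⟨v, .inl hv, w, .inr hw, hIJ.ne_of_mem hv hw⟩

theorem mem_offsets_succ (n : ℕ) (y v : ℝ × ℝ) :
    v ∈ offsets N D (n + 1) y ↔ v ∈ carpet N D ∧ ∃ e ∈ blocks N D n, ∃ d ∈ D,
      y = v + toPlane ((N : ℤ) • e + digitVec d) := by
  constructor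
  · rintro ⟨hv, _, ⟨e, he, d, hd, rfl⟩, hy⟩
    exact ⟨hv, e, he, d, hd, hy⟩
  · rintro ⟨hv, e, he, d, hd, hy⟩
    exact ⟨hv, _, ⟨e, he, d, hd, rfl⟩, hy⟩

/-! ### Reduction to levels 1 and 2 -/

/-- Since `0 ≤ f + d ≤ N`, only `k = 0` with `f = d = 0` and `k = 1` with `f = 1`, `d = N - 1` are
possible. So a corner of a square is the same corner of its subsquare there. -/
theorem eq_intCast_of_add_digit {d : ℕ} (hd : d < N) {f : ℝ} (hf : f ∈ Icc (0 : ℝ) 1) {k : ℤ}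
    (h : f + d = N * k) : f = k := by
  obtain ⟨h0, h1⟩ := hf
  have hd' : (d : ℝ) + 1 ≤ N := by exact_mod_cast hd
  have hN : (0 : ℝ) < N := by linarith [(Nat.cast_nonneg d : (0 : ℝ) ≤ d)]
  have hd0 : (0 : ℝ) ≤ d := Nat.cast_nonneg d
  have k0 : (0 : ℝ) ≤ k := by
    by_contra! hk
    nlinarith
  have k1 : (k : ℝ) ≤ 1 := by
    by_contra! hk
    nlinarith
  have k0' : 0 ≤ k := by exact_mod_cast k0
  have k1' : k ≤ 1 := by exact_mod_cast k1
  obtain rfl | rfl : k = 0 ∨ k = 1 := by omega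
  · push_cast at h ⊢; linarith
  · push_cast at h ⊢; linarith

/-- At a vertex of the grid of level `n`, levels `n` and `n + 1` look alike. -/
theorem offsets_succ_vertex (hD : D.Nonempty) (n : ℕ) (z : ℤ × ℤ) :
    offsets N D (n + 1) ((N : ℝ) • toPlane z) = offsets N D n (toPlane z) := by
  have key {v : ℝ × ℝ} (hv : v ∈ carpet N D) (d : Fin N × Fin N) (k : ℤ × ℤ)
      (h : v + toPlane (digitVec d) = (N : ℝ) • toPlane k) : v = toPlane k := by
    obtain ⟨h1, h2⟩ := Prod.ext_iff.1 h
    obtain ⟨v1, v2⟩ := carpet_subset N D hv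
    ext
    · exact eq_intCast_of_add_digit d.1.2 v1 (by simpa [toPlane, digitVec] using h1)
    · exact eq_intCast_of_add_digit d.2.2 v2 (by simpa [toPlane, digitVec] using h2)
  have hN : (N : ℝ) ≠ 0 := by
    obtain ⟨d, -⟩ := hD
    have := d.1.pos
    positivity
  ext v
  rw [mem_offsets_succ]
  constructor
  · rintro ⟨hv, e, he, d, hd, h⟩
    refine ⟨hv, e, he, ?_⟩
    rw [key hv d (z - e) ?_, ← toPlane_add, sub_add_cancel]
    ext
    · have := congrArg Prod.fst h
      simp [toPlane] at this ⊢
      linarith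
    · have := congrArg Prod.snd h
      simp [toPlane] at this ⊢
      linarith
  · rintro ⟨hv, e, he, h⟩
    refine ⟨hv, e, he, ?_⟩
    obtain ⟨d, hd, f, hf, hfv⟩ := (mem_carpet_iff hD v).1 hv
    have hve : v = toPlane (z - e) := by
      ext
      · have := congrArg Prod.fst h
        simp [toPlane] at this ⊢
        linarith
      · have := congrArg Prod.snd h
        simp [toPlane] at this ⊢
        linarith
    have hf' : f + toPlane (digitVec d) = (N : ℝ) • v := by
      rw [← hfv, phi_eq, smul_inv_smul₀ hN]
    -- The corner `v` is the fixed point of `phi N d`, so the child `d` has the same offset as its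
    -- parent.
    obtain rfl : f = v := (key hf d (z - e) (hve ▸ hf')).trans hve.symm
    refine ⟨d, hd, ?_⟩
    rw [h, smul_add, ← hf', toPlane_add]
    ext <;> simp [toPlane] <;> ring

/-- Matching parents around `z` and `z + τ` gives the same offsets one level below. -/
theorem offsets_succ_congr (n m : ℕ) (z : ℝ × ℝ) (τ : ℤ × ℤ)
    (h : ∀ e, z - toPlane e ∈ (Icc 0 1 ×ˢ Icc 0 1 : Set (ℝ × ℝ)) →
      (e ∈ blocks N D n ↔ e + τ ∈ blocks N D m)) :
    offsets N D (n + 1) ((N : ℝ) • z) = offsets N D (m + 1) ((N : ℝ) • (z + toPlane τ)) := by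
  have key {v : ℝ × ℝ} (hv : v ∈ carpet N D) (e : ℤ × ℤ) (d : Fin N × Fin N)
      (hz : (N : ℝ) • z = v + toPlane ((N : ℤ) • e + digitVec d)) :
      z - toPlane e ∈ (Icc 0 1 ×ˢ Icc 0 1 : Set (ℝ × ℝ)) := by
    have aux {z e v : ℝ} {d : ℕ} (hd : d < N) (hv : v ∈ Icc (0 : ℝ) 1)
        (h : N * z = v + (N * e + d)) : z - e ∈ Icc (0 : ℝ) 1 := by
      have hd' : (d : ℝ) + 1 ≤ N := by exact_mod_cast hd
      have hd0 : (0 : ℝ) ≤ d := Nat.cast_nonneg d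
      have hN : (0 : ℝ) < N := by linarith
      have hze : z - e = (v + d) / N := by
        rw [eq_div_iff hN.ne']
        linarith
      rw [hze]
      exact ⟨div_nonneg (add_nonneg hv.1 hd0) hN.le, (div_le_one hN).2 (by linarith [hv.2])⟩
    obtain ⟨v1, v2⟩ := carpet_subset N D hv
    obtain ⟨h1, h2⟩ := Prod.ext_iff.1 hz
    exact ⟨aux d.1.2 v1 (by simpa [toPlane, digitVec] using h1),
      aux d.2.2 v2 (by simpa [toPlane, digitVec] using h2)⟩
  have shift (v : ℝ × ℝ) (e : ℤ × ℤ) (d : Fin N × Fin N) :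
      (N : ℝ) • (z + toPlane τ) = v + toPlane ((N : ℤ) • (e + τ) + digitVec d) ↔
        (N : ℝ) • z = v + toPlane ((N : ℤ) • e + digitVec d) := by
    have : v + toPlane ((N : ℤ) • (e + τ) + digitVec d) =
        v + toPlane ((N : ℤ) • e + digitVec d) + (N : ℝ) • toPlane τ := by
      ext <;> simp [toPlane] <;> ring
    rw [this, smul_add, add_left_inj]
  ext v
  simp only [mem_offsets_succ]
  refine and_congr_right fun hv => ⟨?_, ?_⟩
  · rintro ⟨e, he, d, hd, hz⟩
    exact ⟨e + τ, (h e (key hv e d hz)).1 he, d, hd, (shift v e d).2 hz⟩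
  · rintro ⟨e, he, d, hd, hz⟩
    rw [← sub_add_cancel e τ] at hz he
    have hz := (shift v (e - τ) d).1 hz
    exact ⟨e - τ, (h _ (key hv _ d hz)).2 he, d, hd, hz⟩

/-- Edge-adjacent blocks occur at level `1` if they occur at any level. -/
theorem exists_adjacent_digits (n : ℕ) (e δ : ℤ × ℤ) (hδ : δ = (1, 0) ∨ δ = (0, 1))
    (he : e ∈ blocks N D n) (he' : e + δ ∈ blocks N D n) :
    ∃ i ∈ blocks N D 1, i + δ ∈ blocks N D 1 := by
  induction n generalizing e with
  | zero =>
    obtain rfl : e = 0 := he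
    have : δ = 0 := by simpa [blocks] using he'
    subst this
    simp [Prod.ext_iff] at hδ
  | succ n ih =>
    obtain ⟨a, ha, d, hd, rfl⟩ := he
    obtain ⟨a', ha', d', hd', h⟩ := he'
    -- In each coordinate a step of `ε` either stays inside the parent or carries into the next one.
    -- As `δ` moves only one coordinate, the parents either coincide or differ by `δ` itself.
    have split {a a' : ℤ} {d d' : ℕ} {ε : ℤ} (hd : d < N) (hd' : d' < N) (h0 : 0 ≤ ε) (h1 : ε ≤ 1)
        (h : N * a + d + ε = N * a' + d') :
        (a' = a ∧ (d' : ℤ) = d + ε) ∨ (ε = 1 ∧ a' = a + 1) := by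
      have hN : (0 : ℤ) < N := by omega
      have b0 : 0 ≤ a' - a := by
        by_contra! hlt
        nlinarith
      have b1 : a' - a ≤ 1 := by
        by_contra! hlt
        nlinarith
      obtain hk | hk : a' = a ∨ a' = a + 1 := by omega
      · subst hk
        exact .inl ⟨rfl, by linarith⟩
      · subst hk
        refine .inr ⟨?_, rfl⟩
        have : (N : ℤ) * (a + 1) = N * a + N := by ring
        omega
    obtain ⟨h1, h2⟩ := Prod.ext_iff.1 h
    simp only [Prod.fst_add, Prod.smul_fst, Prod.snd_add, Prod.smul_snd, smul_eq_mul,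
      digitVec] at h1 h2
    have mem1 {d : Fin N × Fin N} (hd : d ∈ D) : digitVec d ∈ blocks N D 1 :=
      ⟨0, rfl, d, hd, by simp⟩
    have hδ1 : 0 ≤ δ.1 ∧ δ.1 ≤ 1 ∧ 0 ≤ δ.2 ∧ δ.2 ≤ 1 ∧ ¬ (δ.1 = 1 ∧ δ.2 = 1) ∧
      (δ.1 = 1 ∨ δ.2 = 1) := by
      rcases hδ with rfl | rfl <;> simp
    obtain ⟨p1, p2, p3, p4, p5, p6⟩ := hδ1
    have s1 := split d.1.2 d'.1.2 p1 p2 h1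
    have s2 := split d.2.2 d'.2.2 p3 p4 h2
    by_cases haa : a' = a + δ
    · exact ih a ha (haa ▸ ha')
    · refine ⟨_, mem1 hd, ?_⟩
      convert mem1 hd'
      rw [Prod.ext_iff] at haa ⊢
      simp only [Prod.fst_add, Prod.snd_add, digitVec] at haa ⊢
      omega

/-- A non-integral coordinate determines the square in that direction; the other coordinate leaves
at most two choices, `⌈t⌉ - 1` and `⌈t⌉`. -/
theorem exists_edge_of_not_vertex (z : ℝ × ℝ) (hz : ¬ ∃ k, z = toPlane k) :
    ∃ e δ : ℤ × ℤ, (δ = (1, 0) ∨ δ = (0, 1)) ∧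
      ∀ a, z - toPlane a ∈ (Icc 0 1 ×ˢ Icc 0 1 : Set (ℝ × ℝ)) → a = e ∨ a = e + δ := by
  have two {t : ℝ} {a : ℤ} (h : t - a ∈ Icc (0 : ℝ) 1) : a = ⌈t⌉ - 1 ∨ a = ⌈t⌉ := by
    obtain ⟨h0, h1⟩ := h
    have u : a ≤ ⌈t⌉ := by
      have := Int.le_ceil t
      exact_mod_cast (by linarith : (a : ℝ) ≤ ⌈t⌉)
    have l : ⌈t⌉ ≤ a + 1 := Int.ceil_le.2 (by push_cast; linarith)
    omega
  have one {t : ℝ} {a : ℤ} (ht : ¬ ∃ k : ℤ, t = k) (h : t - a ∈ Icc (0 : ℝ) 1) : a = ⌊t⌋ := by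
    obtain ⟨h0, h1⟩ := h
    refine (Int.floor_eq_iff.2 ⟨by linarith, lt_of_le_of_ne (by linarith) fun h => ?_⟩).symm
    exact ht ⟨a + 1, by push_cast; exact h⟩
  by_cases h1 : ∃ k : ℤ, z.1 = k
  · have h2 : ¬ ∃ k : ℤ, z.2 = k := by
      rintro ⟨l, hl⟩
      obtain ⟨k, hk⟩ := h1
      exact hz ⟨(k, l), Prod.ext hk hl⟩
    refine ⟨(⌈z.1⌉ - 1, ⌊z.2⌋), (1, 0), .inl rfl, fun a ⟨ha1, ha2⟩ => ?_⟩
    have b2 := one h2 ha2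
    rcases two ha1 with b1 | b1
    · exact .inl (Prod.ext b1 b2)
    · exact .inr (Prod.ext (by simpa using b1) (by simpa using b2))
  · refine ⟨(⌊z.1⌋, ⌈z.2⌉ - 1), (0, 1), .inr rfl, fun a ⟨ha1, ha2⟩ => ?_⟩
    have b1 := one h1 ha1
    rcases two ha2 with b2 | b2
    · exact .inl (Prod.ext b1 b2)
    · exact .inr (Prod.ext (by simpa using b1) (by simpa using b2))

theorem exists_offsets_level_le_two (hD : D.Nonempty) (n : ℕ) (y : ℝ × ℝ)
    (hy : (offsets N D n y).Nontrivial) :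
    ∃ m, (m = 1 ∨ m = 2) ∧ ∃ y', offsets N D m y' = offsets N D n y := by
  have hN : (N : ℝ) ≠ 0 := by
    obtain ⟨d, -⟩ := hD
    have := d.1.pos
    positivity
  induction n generalizing y with
  | zero =>
    obtain ⟨v, ⟨-, e, he, hv⟩, w, ⟨-, e', he', hw⟩, hvw⟩ := hy
    obtain rfl : e = 0 := he
    obtain rfl : e' = 0 := he'
    exact absurd (add_right_cancel (hv.symm.trans hw)) hvw
  | succ n ih =>
    obtain ⟨z, rfl⟩ : ∃ z, y = (N : ℝ) • z := ⟨(N : ℝ)⁻¹ • y, (smul_inv_smul₀ hN y).symm⟩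
    by_cases hz : ∃ k, z = toPlane k
    · obtain ⟨k, rfl⟩ := hz
      rw [offsets_succ_vertex hD] at hy ⊢
      exact ih _ hy
    obtain ⟨e, δ, hδ, he⟩ := exists_edge_of_not_vertex z hz
    have hδ0 : δ ≠ 0 := by rcases hδ with rfl | rfl <;> simp
    by_cases h1 : e ∈ blocks N D n <;> by_cases h2 : e + δ ∈ blocks N D n
    · obtain ⟨i, hi, hi'⟩ := exists_adjacent_digits n e δ hδ h1 h2
      refine ⟨2, .inr rfl, _, (offsets_succ_congr n 1 z (i - e) fun a ha => ?_).symm⟩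
      rcases he a ha with rfl | rfl
      · simpa [h1] using hi
      · have : e + δ + (i - e) = i + δ := by abel
        simpa [h2, this] using hi'
    · refine ⟨1, .inl rfl, _, (offsets_succ_congr n 0 z (-e) fun a ha => ?_).symm⟩
      rcases he a ha with rfl | rfl
      · simp [h1, blocks]
      · simp [h2, blocks, hδ0]
    · refine ⟨1, .inl rfl, _, (offsets_succ_congr n 0 z (-(e + δ)) fun a ha => ?_).symm⟩
      rcases he a ha with rfl | rfl
      · simp [h1, blocks, hδ0]
      · simp [h2, blocks]
    · obtain ⟨τ, hτ⟩ : ∃ τ : ℤ × ℤ, e + τ ≠ 0 ∧ e + δ + τ ≠ 0 := by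
        -- This sends the two squares to `δ` and `2δ`, both off the only block `0` of level 0.
        refine ⟨-e + δ, by simpa using hδ0, ?_⟩
        rcases hδ with rfl | rfl <;> simp [Prod.ext_iff] <;> omega
      refine ⟨1, .inl rfl, _, (offsets_succ_congr n 0 z τ fun a ha => ?_).symm⟩
      rcases he a ha with rfl | rfl
      · simpa [h1, blocks] using hτ.1
      · simpa [h2, blocks] using hτ.2

/-! ### Cut points and unions of sets through a point -/

/-- If `V \ {x}` lay on one side of a separation of `U \ {x}`, adding `x` to that side would
separate `U`. -/
theorem not_isPreconnected_diff_of_mem_nhdsWithin {α : Type*} [TopologicalSpace α] [T1Space α]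
    {U V : Set α} {x : α} (hU : IsPreconnected U) (hx : x ∈ U) (hVU : V ⊆ U) (hV : V ∈ 𝓝[U] x)
    (h : ¬ IsPreconnected (U \ {x})) : ¬ IsPreconnected (V \ {x}) := by
  intro hVc
  apply h
  obtain ⟨O, hO, hxO, hOV⟩ := mem_nhdsWithin.1 hV
  have key (u v : Set α) (hu : IsOpen u) (hv : IsOpen v) (huv : U \ {x} ⊆ u ∪ v)
      (hvne : (U \ {x} ∩ v).Nonempty) (hVu : V \ {x} ⊆ u) : (U \ {x} ∩ (u ∩ v)).Nonempty := by
    obtain ⟨q, ⟨hqU, hqx⟩, hqv⟩ := hvne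
    obtain ⟨p, hpU, hpu, hpv, hpx⟩ := hU (u ∪ O) (v \ {x}) (hu.union hO)
      (hv.sdiff isClosed_singleton)
      (fun p hp => by
        by_cases hpx : p = x
        · exact .inl (.inr (hpx ▸ hxO))
        · rcases huv ⟨hp, hpx⟩ with h | h
          · exact .inl (.inl h)
          · exact .inr ⟨h, hpx⟩)
      ⟨x, hx, .inr hxO⟩ ⟨q, hqU, hqv, hqx⟩
    refine ⟨p, ⟨hpU, hpx⟩, ?_, hpv⟩
    exact hpu.elim id fun hpO => hVu ⟨hOV ⟨hpO, hpU⟩, hpx⟩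
  intro u v hu hv huv hune hvne
  by_contra hemp
  rw [not_nonempty_iff_eq_empty] at hemp
  have hsub : V \ {x} ⊆ U \ {x} := sdiff_subset_sdiff_left hVU
  rcases isPreconnected_iff_subset_of_disjoint.1 hVc u v hu hv (hsub.trans huv)
    (subset_empty_iff.1 (hemp ▸ inter_subset_inter_left _ hsub)) with h | h
  · exact (key u v hu hv huv hvne h).ne_empty hemp
  · rw [inter_comm u v] at hemp
    exact (key v u hv hu (union_comm u v ▸ huv) hune h).ne_empty hemp

/-- Each `S a \ {x}` lies on one side of a separation, and the sides sort the indices. -/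
theorem exists_partition_of_not_isPreconnected {α ι : Type*} [TopologicalSpace α]
    {A : Set ι} {S : ι → Set α} {x : α} (hx : ∀ a ∈ A, x ∈ S a)
    (hS : ∀ a ∈ A, IsPreconnected (S a \ {x}))
    (h : ¬ IsPreconnected ((⋃ a ∈ A, S a) \ {x})) :
    ∃ I J : Set ι, Disjoint I J ∧ I ∪ J = A ∧ (⋃ a ∈ I, S a) ∩ (⋃ a ∈ J, S a) = {x} := by
  simp only [IsPreconnected, not_forall] at h
  obtain ⟨u, v, hu, hv, huv, ⟨p, ⟨hpA, hpx⟩, hpu⟩, ⟨q, ⟨hqA, hqx⟩, hqv⟩, hemp⟩ := h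
  rw [not_nonempty_iff_eq_empty] at hemp
  have disj {p : α} {a : ι} (ha : a ∈ A) (hp : p ∈ S a) (hpx : p ≠ x) (hpu : p ∈ u)
      (hpv : p ∈ v) : False :=
    (hemp ▸ (⟨⟨mem_biUnion ha hp, hpx⟩, hpu, hpv⟩ :
      p ∈ ((⋃ a ∈ A, S a) \ {x}) ∩ (u ∩ v)) : p ∈ (∅ : Set α))
  have side (a : ι) (ha : a ∈ A) : S a \ {x} ⊆ u ∨ S a \ {x} ⊆ v :=
    isPreconnected_iff_subset_of_disjoint.1 (hS a ha) u v hu hv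
      ((sdiff_subset_sdiff_left (subset_biUnion_of_mem ha)).trans huv)
      (subset_empty_iff.1 (hemp ▸ inter_subset_inter_left _
        (sdiff_subset_sdiff_left (subset_biUnion_of_mem ha))))
  refine ⟨{a ∈ A | S a \ {x} ⊆ u}, {a ∈ A | ¬ S a \ {x} ⊆ u}, ?_, ?_, ?_⟩
  · exact disjoint_left.2 fun a ha ha' => ha'.2 ha.2
  · ext a
    simp only [mem_union, mem_ofPred_eq]
    tauto
  · simp only [mem_iUnion, exists_prop] at hpA hqA
    obtain ⟨a, ha, hpa⟩ := hpA
    obtain ⟨b, hb, hqb⟩ := hqA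
    refine Subset.antisymm ?_ (singleton_subset_iff.2 ⟨?_, ?_⟩)
    · rintro r ⟨hrI, hrJ⟩
      simp only [mem_iUnion, exists_prop] at hrI hrJ
      obtain ⟨c, ⟨hc, hcu⟩, hrc⟩ := hrI
      obtain ⟨c', ⟨hc', hcu'⟩, hrc'⟩ := hrJ
      by_contra hrx
      exact disj hc hrc hrx (hcu ⟨hrc, hrx⟩)
        (((side c' hc').resolve_left hcu') ⟨hrc', hrx⟩)
    · refine mem_biUnion (⟨ha, ?_⟩ : a ∈ {a ∈ A | S a \ {x} ⊆ u}) (hx a ha)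
      exact (side a ha).resolve_right fun hav => disj ha hpa hpx hpu (hav ⟨hpa, hpx⟩)
    · refine mem_biUnion (⟨hb, fun hbu => ?_⟩ : b ∈ {a ∈ A | ¬ S a \ {x} ⊆ u}) (hx b hb)
      exact disj hb hqb hqx (hbu ⟨hqb, hqx⟩) hqv

/-! ### From a local cut point to two classes of words -/

theorem dist_le_one_of_mem_carpet {f g : ℝ × ℝ} (hf : f ∈ carpet N D) (hg : g ∈ carpet N D) :
    dist f g ≤ 1 := by
  obtain ⟨f1, f2⟩ := carpet_subset N D hf
  obtain ⟨g1, g2⟩ := carpet_subset N D hg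
  simp only [Prod.dist_eq, max_le_iff, Real.dist_eq, abs_le]
  exact ⟨⟨by linarith [f1.1, g1.2], by linarith [f1.2, g1.1]⟩,
    by linarith [f2.1, g2.2], by linarith [f2.2, g2.1]⟩

theorem exists_splits_of_isLocalCutPoint (hN : 2 ≤ N) (hD : D.Nonempty)
    (hcut : ¬ ∃ x, IsCutPoint (carpet N D) x) {x : ℝ × ℝ}
    (hx : IsLocalCutPoint (carpet N D) x) :
    ∃ n y, Splits (carpet N D) (offsets N D n y) := by
  obtain ⟨hxF, U, hUF, hU, hUc, hxU, hUx⟩ := hx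
  obtain ⟨ε, hε, hball⟩ := Metric.mem_nhdsWithin_iff.1 hU
  have hN0 : (0 : ℝ) < N := by positivity
  have hN1 : (N : ℝ)⁻¹ < 1 := inv_lt_one_of_one_lt₀ (by exact_mod_cast hN)
  obtain ⟨n, hn⟩ := exists_pow_lt_of_lt_one hε hN1
  rw [inv_pow] at hn
  have hM0 : (0 : ℝ) < (N : ℝ) ^ n := by positivity
  set M : ℝ := (N : ℝ) ^ n with hM
  refine ⟨n, M • x, ?_⟩
  set A := offsets N D n (M • x) with hA
  set S : ℝ × ℝ → Set (ℝ × ℝ) := fun v => (fun f => x + M⁻¹ • (f - v)) '' carpet N D with hS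
  have eqn {v : ℝ × ℝ} {e : ℤ × ℤ} (h : M • x = v + toPlane e) (f : ℝ × ℝ) :
      M⁻¹ • (f + toPlane e) = x + M⁻¹ • (f - v) := by
    rw [eq_sub_of_add_eq' h.symm, smul_add, smul_sub, smul_sub, inv_smul_smul₀ hM0.ne']
    abel
  have hxS (v) (hv : v ∈ A) : x ∈ S v := ⟨v, hv.1, by simp⟩
  have hVF : (⋃ v ∈ A, S v) ⊆ carpet N D := by
    refine iUnion₂_subset ?_
    rintro v ⟨hv, e, he, h⟩ _ ⟨f, hf, rfl⟩
    exact (mem_carpet_iff_blocks hD n _).2 ⟨e, he, f, hf, (eqn h f).symm⟩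
  have hVU : (⋃ v ∈ A, S v) ⊆ U := by
    intro p hp
    refine hball ⟨?_, hVF hp⟩
    simp only [mem_iUnion, exists_prop] at hp
    obtain ⟨v, hv, f, hf, rfl⟩ := hp
    rw [Metric.mem_ball, dist_self_add_left, norm_smul, ← dist_eq_norm, Real.norm_eq_abs,
      abs_of_pos (inv_pos.2 hM0)]
    have := dist_le_one_of_mem_carpet hf hv.1
    calc M⁻¹ * dist f v ≤ M⁻¹ * 1 := by gcongr
      _ < ε := by rwa [mul_one]
  have hV : (⋃ v ∈ A, S v) ∈ 𝓝[U] x := by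
    set T : ℤ × ℤ → Set (ℝ × ℝ) := fun e => (fun f => M⁻¹ • (f + toPlane e)) '' carpet N D
    -- The finitely many cells missing `x` form a closed set; off it, only cells through `x` remain.
    have hT : IsClosed (⋃ e ∈ {e ∈ blocks N D n | x ∉ T e}, T e) := by
      refine ((finite_blocks N D n).subset (sep_subset _ _)).isClosed_biUnion fun e _ => ?_
      exact ((isAttractor_carpet N D hD).2.1.image (by fun_prop)).isClosed
    refine mem_nhdsWithin.2 ⟨_, hT.isOpen_compl, ?_, ?_⟩
    · simp only [mem_compl_iff, mem_iUnion, exists_prop, not_exists, not_and]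
      exact fun e he => he.2
    · rintro p ⟨hpT, hpU⟩
      obtain ⟨e, he, f, hf, rfl⟩ := (mem_carpet_iff_blocks hD n p).1 (hUF hpU)
      have hxe : x ∈ T e := by
        by_contra hxe
        exact hpT (mem_biUnion (⟨he, hxe⟩ : e ∈ {e ∈ blocks N D n | x ∉ T e}) ⟨f, hf, rfl⟩)
      obtain ⟨v, hv, hvx⟩ := hxe
      have hvx' : M • x = v + toPlane e := by rw [← hvx]; exact smul_inv_smul₀ hM0.ne' _
      exact mem_biUnion (⟨hv, e, he, hvx'⟩ : v ∈ A) ⟨f, hf, (eqn hvx' f).symm⟩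
  have hSc (v) (hv : v ∈ A) : IsPreconnected (S v \ {x}) := by
    have hpre : IsPreconnected (carpet N D \ {v}) := by
      by_contra h
      exact hcut ⟨v, hv.1, h⟩
    convert hpre.image (fun f => x + M⁻¹ • (f - v)) (by fun_prop) using 1
    rw [image_sdiff, image_singleton]
    · simp [hS]
    · intro f g hfg
      simpa [hM0.ne'] using hfg
  obtain ⟨I, J, hIJ, hIJA, hint⟩ := exists_partition_of_not_isPreconnected hxS hSc
    (not_isPreconnected_diff_of_mem_nhdsWithin hUc.isPreconnected hxU hVU hV hUx)
  refine ⟨I, J, hIJ, hIJA, fun z => ?_⟩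
  have mem (v : ℝ × ℝ) : x + M⁻¹ • z ∈ S v ↔ z + v ∈ carpet N D := by
    constructor
    · rintro ⟨f, hf, h⟩
      have h : f - v = z := by simpa [hM0.ne'] using h
      rwa [← h, sub_add_cancel]
    · exact fun h => ⟨_, h, by simp⟩
  have h := Set.ext_iff.1 hint (x + M⁻¹ • z)
  simp only [mem_inter_iff, mem_iUnion, exists_prop, mem, mem_singleton_iff] at h
  rw [h]
  simp [hM0.ne']

theorem exists_words_of_splits (hN : 2 ≤ N) (n : ℕ) (y : ℝ × ℝ)
    (h : Splits (carpet N D) (offsets N D n y)) :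
    ∃ I J : Set (Fin n → D), Disjoint I J ∧ ∃ x : ℝ × ℝ,
      (⋃ w ∈ I, cell N D w) ∩ (⋃ w ∈ J, cell N D w) = {x} ∧
        I ∪ J = {w | x ∈ cell N D w} := by
  obtain ⟨I, J, hIJ, hIJA, hint⟩ := h
  have hM0 : (N : ℝ) ^ n ≠ 0 := by positivity
  set M : ℝ := (N : ℝ) ^ n with hM
  choose code hcode hphi using exists_block_of_word (N := N) (D := D) n
  have hcell (w : Fin n → D) (p : ℝ × ℝ) :
      p ∈ cell N D w ↔ M • p - toPlane (code w) ∈ carpet N D := by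
    constructor
    · rintro ⟨f, hf, rfl⟩
      rwa [hphi, smul_inv_smul₀ hM0, add_sub_cancel_right]
    · exact fun h => ⟨_, h, by rw [hphi, sub_add_cancel, inv_smul_smul₀ hM0]⟩
  have hsurj (v) (hv : v ∈ offsets N D n y) : ∃ w, v = y - toPlane (code w) := by
    obtain ⟨-, e, he, rfl⟩ := hv
    obtain ⟨w, hw⟩ := exists_word_of_block n e he
    refine ⟨w, ?_⟩
    have h0 := (hw 0).symm.trans (hphi w 0)
    rw [zero_add, zero_add] at h0
    rw [← smul_right_injective _ (inv_ne_zero hM0) h0, add_sub_cancel_right]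
  have hunion (K : Set (ℝ × ℝ)) (hK : K ⊆ offsets N D n y) (p : ℝ × ℝ) :
      p ∈ (⋃ w ∈ {w | y - toPlane (code w) ∈ K}, cell N D w) ↔
        ∃ v ∈ K, (M • p - y) + v ∈ carpet N D := by
    simp only [mem_iUnion, exists_prop, mem_ofPred_eq, hcell]
    constructor
    · rintro ⟨w, hw, hp⟩
      exact ⟨_, hw, by rwa [sub_add_sub_cancel]⟩
    · rintro ⟨v, hv, hp⟩
      obtain ⟨w, rfl⟩ := hsurj v (hK hv)
      exact ⟨w, hv, by rwa [sub_add_sub_cancel] at hp⟩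
  refine ⟨{w | y - toPlane (code w) ∈ I}, {w | y - toPlane (code w) ∈ J},
    disjoint_left.2 fun w hI hJ => disjoint_left.1 hIJ hI hJ, M⁻¹ • y, ?_, ?_⟩
  · ext p
    rw [mem_inter_iff, hunion I (hIJA ▸ subset_union_left),
      hunion J (hIJA ▸ subset_union_right), hint, mem_singleton_iff, sub_eq_zero,
      eq_inv_smul_iff₀ hM0]
  · ext w
    change y - toPlane (code w) ∈ I ∪ J ↔ M⁻¹ • y ∈ cell N D w
    rw [hIJA, hcell, smul_inv_smul₀ hM0]
    exact ⟨fun h => h.1, fun h => ⟨h, _, hcode w, (sub_add_cancel _ _).symm⟩⟩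

/-! ### From two classes of words to a local cut point -/

theorem nontrivial_carpet (hD : 1 < D.card) : (carpet N D).Nontrivial := by
  obtain ⟨i, hi, j, hj, hij⟩ := Finset.one_lt_card.1 hD
  have hDne : D.Nonempty := ⟨i, hi⟩
  obtain ⟨f, hf⟩ := (isAttractor_carpet N D hDne).1
  refine ⟨phi N i f, (mem_carpet_iff hDne _).2 ⟨i, hi, f, hf, rfl⟩,
    phi N j f, (mem_carpet_iff hDne _).2 ⟨j, hj, f, hf, rfl⟩, fun h => hij ?_⟩
  have hN : (N : ℝ) ≠ 0 := by
    have := i.1.pos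
    positivity
  obtain ⟨h1, h2⟩ := Prod.ext_iff.1 h
  simp only [phi, div_left_inj' hN, add_right_inj, Nat.cast_inj] at h1 h2
  exact Prod.ext (Fin.ext h1) (Fin.ext h2)

theorem isLocalCutPoint_of_words (hD : 1 < D.card) (hconn : IsConnected (carpet N D))
    {n : ℕ} {I J : Set (Fin n → D)} {x : ℝ × ℝ}
    (hx : (⋃ w ∈ I, cell N D w) ∩ (⋃ w ∈ J, cell N D w) = {x})
    (hIJ : I ∪ J = {w | x ∈ cell N D w}) : IsLocalCutPoint (carpet N D) x := by
  have hDne : D.Nonempty := Finset.card_pos.1 (by omega)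
  have hM0 : (N : ℝ) ^ n ≠ 0 := by
    obtain ⟨d, -⟩ := hDne
    have := d.1.pos
    positivity
  have hcont (w : Fin n → D) : Continuous (phiWord N D n w) := by
    obtain ⟨e, -, h⟩ := exists_block_of_word n w
    rw [funext h]
    fun_prop
  have hinj (w : Fin n → D) : Function.Injective (phiWord N D n w) := by
    obtain ⟨e, -, h⟩ := exists_block_of_word n w
    intro f g hfg
    rw [h, h] at hfg
    exact add_right_cancel (smul_right_injective _ (inv_ne_zero hM0) hfg)
  have hsub (w : Fin n → D) : cell N D w ⊆ carpet N D := by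
    obtain ⟨e, he, h⟩ := exists_block_of_word n w
    rintro _ ⟨f, hf, rfl⟩
    exact (mem_carpet_iff_blocks hDne n _).2 ⟨e, he, f, hf, h f⟩
  have hcover {p : ℝ × ℝ} (hp : p ∈ carpet N D) : ∃ w : Fin n → D, p ∈ cell N D w := by
    obtain ⟨e, he, f, hf, rfl⟩ := (mem_carpet_iff_blocks hDne n p).1 hp
    obtain ⟨w, hw⟩ := exists_word_of_block n e he
    exact ⟨w, f, hf, hw f⟩
  have hclosed (K : Set (Fin n → D)) : IsClosed (⋃ w ∈ K, cell N D w) :=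
    K.toFinite.isClosed_biUnion fun w _ =>
      ((isAttractor_carpet N D hDne).2.1.image (hcont w)).isClosed
  have hcellc (w : Fin n → D) : IsConnected (cell N D w) :=
    hconn.image _ (hcont w).continuousOn
  have hxmem : x ∈ (⋃ w ∈ I, cell N D w) ∩ (⋃ w ∈ J, cell N D w) := hx ▸ mem_singleton x
  -- Cells are not single points, so both closed pieces survive the removal of `x`.
  have hother {K : Set (Fin n → D)} (hK : x ∈ ⋃ w ∈ K, cell N D w) :
      ∃ p ∈ ⋃ w ∈ K, cell N D w, p ≠ x := by
    simp only [mem_iUnion, exists_prop] at hK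
    obtain ⟨w, hw, -⟩ := hK
    obtain ⟨p, hp, hpx⟩ := ((nontrivial_carpet hD).image (hinj w)).exists_ne x
    exact ⟨p, mem_biUnion hw hp, hpx⟩
  have hxw {w : Fin n → D} (hw : w ∈ I ∪ J) : x ∈ cell N D w := by
    rw [hIJ] at hw
    exact hw
  have hxU : x ∈ ⋃ w ∈ I ∪ J, cell N D w := by
    rw [biUnion_union]
    exact .inl hxmem.1
  have hxF : x ∈ carpet N D := iUnion₂_subset (fun w _ => hsub w) hxU
  refine ⟨hxF, ⋃ w ∈ I ∪ J, cell N D w, iUnion₂_subset fun w _ => hsub w, ?_, ⟨⟨x, hxU⟩, ?_⟩,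
    hxU, fun hpre => ?_⟩
  · refine mem_nhdsWithin.2 ⟨_, (hclosed (I ∪ J)ᶜ).isOpen_compl, ?_, ?_⟩
    · simp only [mem_compl_iff, mem_iUnion, exists_prop, not_exists, not_and]
      intro w hw hxw
      exact hw (hIJ ▸ hxw)
    · rintro p ⟨hp, hpF⟩
      obtain ⟨w, hw⟩ := hcover hpF
      refine mem_biUnion ?_ hw
      by_contra hwIJ
      exact hp (mem_biUnion hwIJ hw)
  · refine isPreconnected_of_forall x fun p hp => ?_
    simp only [mem_iUnion, exists_prop] at hp
    obtain ⟨w, hw, hpw⟩ := hp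
    exact ⟨_, subset_biUnion_of_mem (u := fun w => cell N D w) hw, hxw hw, hpw,
      (hcellc w).isPreconnected⟩
  · rw [biUnion_union] at hpre
    obtain ⟨p, hp, hpx⟩ := hother hxmem.1
    obtain ⟨q, hq, hqx⟩ := hother hxmem.2
    obtain ⟨r, hr, hrI, hrJ⟩ := isPreconnected_closed_iff.1 hpre _ _ (hclosed I) (hclosed J)
      sdiff_subset ⟨p, ⟨.inl hp, hpx⟩, hp⟩ ⟨q, ⟨.inr hq, hqx⟩, hq⟩
    exact hr.2 (hx ▸ ⟨hrI, hrJ⟩)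

end GSC

theorem theorem1p4 (N : ℕ) (hN : 2 ≤ N) (D : Finset (Fin N × Fin N))
    (hD : 1 < D.card) (hD' : D.card < N ^ 2)
    (hconn : IsConnected (GSC.carpet N D))
    (hcut : ¬ ∃ x, GSC.IsCutPoint (GSC.carpet N D) x) :
    (∃ x, GSC.IsLocalCutPoint (GSC.carpet N D) x) ↔
      ∃ n : ℕ, (n = 1 ∨ n = 2) ∧ ∃ I J : Set (Fin n → D), Disjoint I J ∧
        ∃ x : ℝ × ℝ,
          (⋃ w ∈ I, GSC.cell N D w) ∩ (⋃ w ∈ J, GSC.cell N D w) = {x} ∧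
          I ∪ J = {w | x ∈ GSC.cell N D w} := by
  have hDne : D.Nonempty := Finset.card_pos.1 (by omega)
  constructor
  · rintro ⟨x, hx⟩
    obtain ⟨n, y, h⟩ := GSC.exists_splits_of_isLocalCutPoint hN hDne hcut hx
    obtain ⟨m, hm, y', hy'⟩ := GSC.exists_offsets_level_le_two hDne n y h.nontrivial
    exact ⟨m, hm, GSC.exists_words_of_splits hN m y' (hy' ▸ h)⟩
  · rintro ⟨n, -, I, J, -, x, hx, hIJ⟩
    exact ⟨x, GSC.isLocalCutPoint_of_words hD hconn hx hIJ⟩
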